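/- Let $R$ be a GCD domain (an integral domain in which any two elements have a greatest common divisor). Let $G$ be a finite simple graph with vertices $v_1,\dots,v_n$, not necessarily connected, and let each edge $e$ of $G$ be labeled by a nonzero principal ideal $\alpha(e)=(l_e)$ of $R$, where $l_e$ is any chosen generator. The module of generalized splines is $$R_{(G,\alpha)}=\{F\in R^{V(G)} : F(u)-F(v)\in\alpha(uv)\text{ for every edge }uv\text{ of }G\}.$$ A zero trail of $v_i$ is a trail (a walk with no repeated edge) in $G$ from $v_i$ to some $v_j$ with $j<i$. Let $\mathscr{L}_i\in R$ be the least common multiple, over all zero trails $p$ of $v_i$, of the greatest common divisor of the labels $l_e$ of the edges $e$ on $p$, where the least common multiple of the empty family is $1$ (so $\mathscr{L}_1=1$), and let $Q_G=\prod_{i=1}^n\mathscr{L}_i$; it is determined up to a unit of $R$. For $F_1,\dots,F_n\in R_{(G,\alpha)}$ let $|F_1\ F_2\ \cdots\ F_n|$ denote the determinant of the $n\times n$ matrix whose $c$-th column is $(F_c(v_n),\dots,F_c(v_2),F_c(v_1))^{T}$. Then, for all $F_1,\dots,F_n\in R_{(G,\alpha)}$, the elements $F_1,\dots,F_n$ form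 an $R$-module basis of $R_{(G,\alpha)}$ if and only if $|F_1\ F_2\ \cdots\ F_n|=r\cdot Q_G$ for some unit $r\in R$. -/

import Mathlib

namespace GenSpline

/-- The `R`-module of generalized splines on the edge-labeled graph `(G, α)`, where `α` labels the
edges of `G` by ideals of `R`: all vertex labelings `F` with `F u - F v ∈ α(uv)` for every edge
`uv`. The module structure is the componentwise one. -/
def splineModule {V R : Type*} [CommRing R] (G : SimpleGraph V) (α : G.EdgeLabeling (Ideal R)) :
    Submodule R (V → R) where
  carrier := {F | ∀ (u v : V) (h : G.Adj u v), F u - F v ∈ α ⟨s(u, v), h⟩}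
  zero_mem' := by
    intro u v h
    simp
  add_mem' := by
    intro F F' hF hF' u v h
    have := (α ⟨s(u, v), h⟩).add_mem (hF u v h) (hF' u v h)
    simpa only [Pi.add_apply, add_sub_add_comm] using this
  smul_mem' := by
    intro r F hF u v h
    have := (α ⟨s(u, v), h⟩).mul_mem_left r (hF u v h)
    simpa only [Pi.smul_apply, smul_eq_mul, mul_sub] using this

/-- The greatest common divisor of the edge labels along a walk `p`, for edge labels that are
elements of `R` (generators of principal ideals). -/
def walkGcd {V R : Type*} [CommRing R] [NormalizedGCDMonoid R] {G : SimpleGraph V}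
    (l : G.EdgeLabeling R) {u v : V} (p : G.Walk u v) : R :=
  Multiset.gcd (Multiset.ofList
    (p.edges.attach.map fun e => l ⟨e.1, p.edges_subset_edgeSet e.2⟩))

/-- The zero trails of the vertex `i` of a graph on the ordered vertices `0, …, n - 1`: the trails
(walks without repeated edges) that start at `i` and end at some vertex `j < i`. -/
def zeroTrails {n : ℕ} (G : SimpleGraph (Fin n)) (i : Fin n) : Set (Σ j : Fin n, G.Walk i j) :=
  {p | p.1 < i ∧ p.2.IsTrail}

theorem zeroTrails_finite {n : ℕ} (G : SimpleGraph (Fin n)) (i : Fin n) :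
    (zeroTrails G i).Finite := by
  classical
  have key : ∀ j : Fin n, {p : G.Walk i j | p.length < G.edgeFinset.card + 1}.Finite := fun j =>
    Set.toFinite _
  refine (Set.finite_iUnion fun j => (key j).image (Sigma.mk j)).subset ?_
  rintro ⟨j, p⟩ hp
  exact Set.mem_iUnion.2 ⟨j, p, Nat.lt_succ_of_le hp.2.length_le_card_edgeFinset, rfl⟩

/-- The element `𝓛_i`: the least common multiple, over all zero trails of the vertex `i`, of the
greatest common divisor of the edge labels on the trail. The lcm of the empty family is `1`; in
particular `𝓛 = 1` for the first vertex, which has no zero trails. -/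
noncomputable def trailLcm {n : ℕ} {R : Type*} [CommRing R] [NormalizedGCDMonoid R]
    {G : SimpleGraph (Fin n)} (l : G.EdgeLabeling R) (i : Fin n) : R :=
  (zeroTrails_finite G i).toFinset.lcm fun p => walkGcd l p.2

/-- The element `Q_G = ∏ 𝓛_i`. -/
noncomputable def graphQ {n : ℕ} {R : Type*} [CommRing R] [NormalizedGCDMonoid R]
    {G : SimpleGraph (Fin n)} (l : G.EdgeLabeling R) : R :=
  ∏ i : Fin n, trailLcm l i

/-- The spline matrix of `F 0, …, F (n - 1)`: column `c` lists the values of `F c`, the last vertex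
in the top row and the first vertex in the bottom row. -/
def splineMatrix {n : ℕ} {R : Type*} [CommRing R] {G : SimpleGraph (Fin n)}
    {α : G.EdgeLabeling (Ideal R)} (F : Fin n → splineModule G α) : Matrix (Fin n) (Fin n) R :=
  Matrix.of fun r c => (F c : Fin n → R) (Fin.rev r)

end GenSpline

namespace GenSpline

/-! ### Distributivity of gcd over lcm -/

section GCDMonoid

variable {R : Type*} [CommRing R] [NormalizedGCDMonoid R]

/-! Up to a unit, `graphQ l` divides the determinant of any `n` splines, and the determinant of a
basis divides `graphQ l`. Lower bound (`graphQ_dvd_det`): along a zero trail from `i` to `j`, the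
gcd of the labels divides `F i - F j`, so unitriangular row operations extract one such gcd from
each row. Upper bound (`det_dvd_graphQ`): a set `S` with least vertex `i` carries the spline equal
to `cutLcm l S` on `S` and 0 elsewhere. One such spline per vertex gives a triangular matrix, whose
determinant a basis determinant divides. A max-min duality between trails and cuts
(`dvd_trailLcm_of_dvd_cutLcm`), resting on distributivity, turns these products into `graphQ l`.
Conversely, Cramer's rule makes `F` a basis once its determinant divides `graphQ l`. -/

theorem dvd_mul_gcd {k x y z : R} (hy : k ∣ x * y) (hz : k ∣ x * z) : k ∣ x * gcd y z :=
  (dvd_gcd hy hz).trans (gcd_mul_left' x y z).dvd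

variable [IsDomain R]

/-- The divisibility order of a GCD domain is distributive. -/
theorem gcd_lcm_dvd {d a b m : R} (ha : gcd d a ∣ m) (hb : gcd d b ∣ m) :
    gcd d (lcm a b) ∣ m := by
  set h := gcd d (lcm a b) with hh
  have hd : h ∣ d := gcd_dvd_left _ _
  have hlcm : h ∣ lcm a b := gcd_dvd_right _ _
  have ha' : gcd h a ∣ m := (gcd_dvd_gcd hd dvd_rfl).trans ha
  have hb' : gcd h b ∣ m := (gcd_dvd_gcd hd dvd_rfl).trans hb
  set g := gcd (gcd h a) (gcd h b) with hg
  have hgh : g ∣ h := (gcd_dvd_left _ _).trans (gcd_dvd_left _ _)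
  have hga : g ∣ a := (gcd_dvd_left _ _).trans (gcd_dvd_right _ _)
  have hgb : g ∣ b := (gcd_dvd_right _ _).trans (gcd_dvd_right _ _)
  by_cases hg0 : g = 0
  · have hgcd0 : gcd h a = 0 := ((gcd_eq_zero_iff _ _).1 (hg.symm.trans hg0)).1
    rw [hgcd0, zero_dvd_iff] at ha'
    simp [ha']
  -- It is enough to check the products `h * h`, `h * b`, `a * h`, `a * b`; the last uses `gcd a b *
  -- lcm a b ~ a * b`.
  have h1 : h * g ∣ gcd h a * gcd h b := by
    have hab : h * g ∣ a * b :=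
      (mul_comm (gcd a b) (lcm a b) ▸ mul_dvd_mul hlcm (dvd_gcd hga hgb)).trans
        (gcd_mul_lcm a b).dvd
    refine dvd_mul_gcd ?_ ?_
    · rw [mul_comm (gcd h a)]
      exact dvd_mul_gcd (mul_dvd_mul_left h hgh) (mul_dvd_mul_left h hga)
    · rw [mul_comm (gcd h a)]
      refine dvd_mul_gcd ?_ (mul_comm a b ▸ hab)
      rw [mul_comm b]
      exact mul_dvd_mul_left h hgb
  have h2 : gcd h a * gcd h b ∣ m * g :=
    dvd_mul_gcd ((mul_comm (gcd h a) (gcd h b)).dvd.trans (mul_dvd_mul_right hb' _)) (mul_dvd_mul_right ha' _)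
  exact (mul_dvd_mul_iff_right hg0).1 (h1.trans h2)

theorem dvd_of_dvd_finset_lcm {β : Type*} {s : Finset β} {f : β → R} {d m : R}
    (hd : d ∣ s.lcm f) (h : ∀ i ∈ s, gcd d (f i) ∣ m) : d ∣ m := by
  classical
  have key : gcd d (s.lcm f) ∣ m := by
    clear hd
    induction s using Finset.induction_on with
    | empty => simp
    | insert a s has ih =>
      rw [Finset.lcm_insert]
      exact gcd_lcm_dvd (h a (Finset.mem_insert_self a s))
        (ih fun i hi => h i (Finset.mem_insert_of_mem hi))
  exact (dvd_gcd dvd_rfl hd).trans key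

end GCDMonoid

/-- To prove a property of `∏ L i`, replace the factors one at a time by elements of `T i`. -/
theorem prod_of_forall_mem {ι R : Type*} [Fintype ι] [CommMonoid R] {P : R → Prop}
    {T : ι → Set R} {L : ι → R} (hL : ∀ i c, (∀ x ∈ T i, P (x * c)) → P (L i * c))
    (h : ∀ x : ι → R, (∀ i, x i ∈ T i) → P (∏ i, x i)) : P (∏ i, L i) := by
  classical
  have key : ∀ (s : Finset ι) (y : ι → R), (∀ i ∈ s, y i = L i) → (∀ i ∉ s, y i ∈ T i) →
      P (∏ i, y i) := by
    intro s
    induction s using Finset.induction_on with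
    | empty => exact fun y _ hy => h y fun i => hy i (Finset.notMem_empty i)
    | insert a s has ih =>
      intro y hy hy'
      rw [← Finset.mul_prod_erase _ _ (Finset.mem_univ a), hy a (Finset.mem_insert_self a s)]
      refine hL a _ fun x hx => ?_
      have hupd : x * ∏ i ∈ Finset.univ.erase a, y i = ∏ i, Function.update y a x i := by
        rw [← Finset.mul_prod_erase _ _ (Finset.mem_univ a), Function.update_self]
        congr 1
        refine Finset.prod_congr rfl fun i hi => ?_
        rw [Function.update_of_ne (Finset.ne_of_mem_erase hi)]
      rw [hupd]
      refine ih _ (fun i hi => ?_) fun i hi => ?_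
      · rw [Function.update_of_ne (by rintro rfl; exact has hi)]
        exact hy i (Finset.mem_insert_of_mem hi)
      · by_cases hia : i = a
        · subst hia
          simpa using hx
        · rw [Function.update_of_ne hia]
          exact hy' i (by simp [hia, hi])
  exact key Finset.univ L (fun _ _ => rfl) fun i hi => absurd (Finset.mem_univ i) hi

section Walk

variable {V R : Type*} [CommRing R]

theorem dvd_walkGcd_iff [NormalizedGCDMonoid R] {G : SimpleGraph V} {l : G.EdgeLabeling R}
    {u v : V} {p : G.Walk u v} {d : R} :
    d ∣ walkGcd l p ↔ ∀ e (he : e ∈ p.edges), d ∣ l ⟨e, p.edges_subset_edgeSet he⟩ := by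
  simp only [walkGcd, Multiset.dvd_gcd, Multiset.mem_coe, List.mem_map, List.mem_attach, true_and,
    Subtype.exists]
  constructor
  · intro h e he
    exact h _ ⟨e, he, rfl⟩
  · rintro h _ ⟨e, he, rfl⟩
    exact h e he

theorem dvd_sub_of_walk {G : SimpleGraph V} {α : G.EdgeLabeling (Ideal R)}
    {l : G.EdgeLabeling R} (hl : ∀ e, α e = Ideal.span {l e}) {F : V → R}
    (hF : F ∈ splineModule G α) {d : R} {u v : V} (p : G.Walk u v)
    (h : ∀ e (he : e ∈ p.edges), d ∣ l ⟨e, p.edges_subset_edgeSet he⟩) : d ∣ F u - F v := by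
  induction p with
  | nil => simp
  | @cons u v w huv p ih =>
    have h1 : d ∣ F u - F v := by
      have := hF u v huv
      rw [hl, Ideal.mem_span_singleton] at this
      exact (h s(u, v) (by simp)).trans this
    have h2 : d ∣ F v - F w := ih fun e he => h e (by simp [he])
    simpa using dvd_add h1 h2

end Walk

/-! ### Cuts and the trail-cut duality -/

section Cut

variable {n : ℕ} {R : Type*} [CommRing R] [NormalizedGCDMonoid R] {G : SimpleGraph (Fin n)}

/-- The edges of `G` with exactly one endpoint in `S`. -/
def cutEdges (G : SimpleGraph (Fin n)) (S : Set (Fin n)) : Set G.edgeSet :=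
  {e | ∃ u ∈ S, ∃ v ∉ S, e.1 = s(u, v)}

/-- The least common multiple of the labels on the edges leaving `S`. -/
noncomputable def cutLcm (l : G.EdgeLabeling R) (S : Set (Fin n)) : R :=
  (Set.toFinite (cutEdges G S)).toFinset.lcm l

/-- The sets that contain `i` and no vertex smaller than `i`. -/
def leadingSets (i : Fin n) : Set (Set (Fin n)) :=
  {S | i ∈ S ∧ ∀ j < i, j ∉ S}

open Classical in
theorem cutSpline_mem {α : G.EdgeLabeling (Ideal R)} {l : G.EdgeLabeling R}
    (hl : ∀ e, α e = Ideal.span {l e}) (S : Set (Fin n)) :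
    (fun v => if v ∈ S then cutLcm l S else 0) ∈ splineModule G α := by
  intro u v h
  have key : ∀ e ∈ cutEdges G S, l e ∣ cutLcm l S := fun e he => Finset.dvd_lcm (by simpa using he)
  rw [hl, Ideal.mem_span_singleton]
  by_cases hu : u ∈ S <;> by_cases hv : v ∈ S <;> simp only [hu, hv, if_true, if_false]
  · simp
  · simpa using key _ ⟨u, hu, v, hv, rfl⟩
  · simpa using key _ ⟨v, hv, u, hu, Sym2.eq_swap⟩
  · simp

/-- Bottleneck duality: the gcd of the cut values divides the lcm of the trail values. -/
theorem dvd_trailLcm_of_dvd_cutLcm [IsDomain R] (l : G.EdgeLabeling R) (i : Fin n)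
    (H : SimpleGraph (Fin n)) (hHG : H ≤ G) {d : R}
    (hH : ∀ e : G.edgeSet, e.1 ∈ H.edgeSet → d ∣ l e)
    (hd : ∀ S ∈ leadingSets i, d ∣ cutLcm l S) : d ∣ trailLcm l i := by
  classical
  -- `H` grows inside `G` while `d` shrinks, so that `d` keeps dividing every label on `H`.
  induction H using WellFoundedGT.induction generalizing d with
  | ind H ih =>
    by_cases hex : ∃ j < i, H.Reachable i j
    · obtain ⟨j, hj, hij⟩ := hex
      obtain ⟨p, hp⟩ := hij.exists_isPath
      have hdvd : d ∣ walkGcd l (p.mapLe hHG) := by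
        rw [dvd_walkGcd_iff]
        intro e he
        refine hH _ (p.edges_subset_edgeSet ?_)
        simpa using he
      refine hdvd.trans ?_
      have hmem : (⟨j, p.mapLe hHG⟩ : Σ j : Fin n, G.Walk i j) ∈
          (zeroTrails_finite G i).toFinset := by
        simpa [zeroTrails, hj] using hp.isTrail
      exact Finset.dvd_lcm (f := fun p : Σ j : Fin n, G.Walk i j => walkGcd l p.2) hmem
    · push Not at hex
      -- The `H`-component of `i` is a leading set. By distributivity, each edge `e` leaving it can
      -- be treated alone: add `e` to `H` and replace `d` by `gcd d (l e)`.
      refine dvd_of_dvd_finset_lcm (hd {v | H.Reachable i v} ⟨SimpleGraph.Reachable.rfl, hex⟩) ?_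
      intro e he
      obtain ⟨u, hu, v, hv, huv⟩ := (Set.Finite.mem_toFinset _).1 he
      have hadj : G.Adj u v := by
        rw [← SimpleGraph.mem_edgeSet, ← huv]
        exact e.2
      have hnadj : ¬ H.Adj u v := fun h => hv (SimpleGraph.Reachable.trans hu h.reachable)
      refine ih (H ⊔ SimpleGraph.edge u v) (SimpleGraph.lt_sup_edge _ _ _ hadj.ne hnadj)
        (sup_le hHG ?_) ?_ fun S hS => (gcd_dvd_left _ _).trans (hd S hS)
      · exact (SimpleGraph.edge_le_iff _).2 (Or.inr hadj)
      · intro e' he'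
        rw [SimpleGraph.edgeSet_sup, Set.mem_union] at he'
        rcases he' with he' | he'
        · exact (gcd_dvd_left _ _).trans (hH e' he')
        · rw [SimpleGraph.edgeSet_edge_of_ne hadj.ne, Set.mem_singleton_iff, ← huv] at he'
          rw [Subtype.ext he']
          exact gcd_dvd_right _ _

theorem dvd_trailLcm_mul [IsDomain R] (l : G.EdgeLabeling R) (i : Fin n) {D c : R}
    (h : ∀ S ∈ leadingSets i, D ∣ cutLcm l S * c) : D ∣ trailLcm l i * c := by
  set s := (Set.toFinite (leadingSets i)).toFinset
  have h1 : D ∣ s.gcd (cutLcm l) * c :=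
    (Finset.dvd_gcd fun S hS => h S (by simpa [s] using hS)).trans
      (Finset.gcd_mul_right' s (cutLcm l) c).dvd
  have h2 : s.gcd (cutLcm l) ∣ trailLcm l i :=
    dvd_trailLcm_of_dvd_cutLcm l i ⊥ bot_le (by simp)
      fun S hS => Finset.gcd_dvd (by simpa [s] using hS)
  exact h1.trans (mul_dvd_mul_right h2 c)

/-- A zero trail ends below `i`, so it has an edge, and one nonzero label makes the gcd nonzero. -/
theorem trailLcm_ne_zero [IsDomain R] {l : G.EdgeLabeling R} (hl0 : ∀ e, l e ≠ 0) (i : Fin n) :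
    trailLcm l i ≠ 0 := by
  rw [trailLcm, Ne, Finset.lcm_eq_zero_iff]
  rintro ⟨⟨j, p⟩, hp, h0⟩
  have hp' : (⟨j, p⟩ : Σ j : Fin n, G.Walk i j) ∈ zeroTrails G i := by simpa using hp
  cases p with
  | nil => exact lt_irrefl _ hp'.1
  | @cons _ v _ huv q =>
    have h0' : (0 : R) ∣ walkGcd l (SimpleGraph.Walk.cons huv q) := by
      simp only at h0
      rw [h0]
    exact hl0 _ (zero_dvd_iff.1 (dvd_walkGcd_iff.1 h0' s(i, v) (by simp)))

end Cut

/-! ### Determinants of splines -/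

section Det

variable {n : ℕ} {R : Type*} [CommRing R] {G : SimpleGraph (Fin n)}
  {α : G.EdgeLabeling (Ideal R)}

/-- The matrix of values of `n` splines, the first vertex in the top row. -/
def valueMatrix (F : Fin n → splineModule G α) : Matrix (Fin n) (Fin n) R :=
  Matrix.of fun r c => (F c : Fin n → R) r

theorem associated_det_splineMatrix (F : Fin n → splineModule G α) :
    Associated (splineMatrix F).det (valueMatrix F).det := by
  have h : splineMatrix F = (valueMatrix F).submatrix (Fin.revPerm : Equiv.Perm (Fin n)) id := rfl
  rw [h, Matrix.det_permute]
  exact associated_unit_mul_left _ _ ((Equiv.Perm.sign _).isUnit.map (Int.castRingHom R))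

theorem prod_dvd_det {F : Fin n → splineModule G α} {x : Fin n → R}
    (hx : ∀ i, x i = 1 ∨ ∃ j < i, ∀ c, x i ∣ (F c : Fin n → R) i - (F c : Fin n → R) j) :
    ∏ i, x i ∣ (valueMatrix F).det := by
  classical
  -- Row `i` of the unitriangular matrix is `e_i` or `e_i - e_j`.
  have key : ∀ i, ∃ a : Fin n → R, a i = 1 ∧ (∀ j, i < j → a j = 0) ∧
      ∀ c, x i ∣ ∑ j, a j * (F c : Fin n → R) j := by
    intro i
    rcases hx i with h1 | ⟨j, hj, h⟩
    · exact ⟨Pi.single i 1, by simp, fun j hj => by simp [hj.ne'], fun c => by simp [h1]⟩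
    · refine ⟨Pi.single i 1 - Pi.single j 1, by simp [hj.ne'], fun k hk => ?_, fun c => ?_⟩
      · simp [hk.ne', (hj.trans hk).ne']
      · simpa [sub_mul, Finset.sum_sub_distrib, Pi.single_apply] using h c
  choose a ha1 ha0 ha using key
  choose b hb using ha
  have hprod : Matrix.of a * valueMatrix F = Matrix.of fun i c => x i * Matrix.of b i c := by
    ext i c
    simpa [Matrix.mul_apply, valueMatrix] using hb i c
  have hdet : (Matrix.of a).det = 1 := by
    rw [Matrix.det_of_isLowerTriangular]
    · simp [ha1]
    · intro i j hij
      exact ha0 i j hij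
  have := congrArg Matrix.det hprod
  rw [Matrix.det_mul, hdet, one_mul, Matrix.det_mul_column] at this
  exact ⟨_, this⟩

variable [IsDomain R] [NormalizedGCDMonoid R] {l : G.EdgeLabeling R}

theorem graphQ_dvd_det (hl : ∀ e, α e = Ideal.span {l e}) (F : Fin n → splineModule G α) :
    graphQ l ∣ (valueMatrix F).det := by
  refine prod_of_forall_mem (P := fun x => x ∣ (valueMatrix F).det)
    -- The extra 1 covers vertices without zero trails and gives `c ∣ det`, so `c` can be cancelled
    -- before taking the lcm.
    (T := fun i => insert 1 ((fun p => walkGcd l p.2) '' zeroTrails G i)) (fun i c h => ?_)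
    fun x hx => prod_dvd_det fun i => ?_
  · by_cases hc : c = 0
    · simpa [hc] using h 1 (Set.mem_insert _ _)
    obtain ⟨k, hk⟩ : c ∣ (valueMatrix F).det := by simpa using h 1 (Set.mem_insert _ _)
    have : trailLcm l i ∣ k := Finset.lcm_dvd fun p hp => by
      have := h _ (Set.mem_insert_of_mem _ ⟨p, by simpa using hp, rfl⟩)
      rw [hk, mul_comm c] at this
      exact (mul_dvd_mul_iff_right hc).1 this
    rw [hk, mul_comm c]
    exact mul_dvd_mul_right this c
  · rcases hx i with h1 | ⟨⟨j, p⟩, hp, hpx⟩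
    · exact Or.inl h1
    · refine Or.inr ⟨j, hp.1, fun c => dvd_sub_of_walk hl (F c).2 p (dvd_walkGcd_iff.1 ?_)⟩
      rw [← hpx]

theorem det_dvd_graphQ (hl : ∀ e, α e = Ideal.span {l e})
    (b : Module.Basis (Fin n) R (splineModule G α)) : (valueMatrix b).det ∣ graphQ l := by
  classical
  refine prod_of_forall_mem (P := fun x => (valueMatrix b).det ∣ x)
    (T := fun i => cutLcm l '' leadingSets i)
    (fun i c h => dvd_trailLcm_mul l i fun S hS => h _ ⟨S, hS, rfl⟩) fun x hx => ?_
  choose S hS hx using hx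
  let H : Fin n → splineModule G α := fun c => ⟨_, cutSpline_mem hl (S c)⟩
  have hmul : valueMatrix H = valueMatrix b * Matrix.of fun k c => b.repr (H c) k := by
    ext r c
    have := congrArg (fun f : splineModule G α => (f : Fin n → R) r) (b.sum_repr (H c))
    simp only [Submodule.coe_sum, Submodule.coe_smul, Finset.sum_apply, Pi.smul_apply,
      smul_eq_mul] at this
    simp only [valueMatrix, Matrix.mul_apply, Matrix.of_apply]
    rw [← this]
    exact Finset.sum_congr rfl fun _ _ => mul_comm _ _
  have hdet : (valueMatrix H).det = ∏ i, x i := by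
    rw [Matrix.det_of_isLowerTriangular]
    · refine Finset.prod_congr rfl fun i _ => ?_
      simp [valueMatrix, H, (hS i).1, hx]
    · intro i j hij
      simp [valueMatrix, H, (hS j).2 i hij]
  rw [← hdet, hmul, Matrix.det_mul]
  exact dvd_mul_right _ _

theorem exists_basis_of_det_dvd_graphQ (hl : ∀ e, α e = Ideal.span {l e}) (hl0 : ∀ e, l e ≠ 0)
    {F : Fin n → splineModule G α} (hF : (valueMatrix F).det ∣ graphQ l) :
    ∃ b : Module.Basis (Fin n) R (splineModule G α), ∀ i, b i = F i := by
  have hdet : (valueMatrix F).det ≠ 0 := by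
    intro h
    rw [h, zero_dvd_iff] at hF
    exact Finset.prod_ne_zero_iff.2 (fun i _ => trailLcm_ne_zero hl0 i) hF
  have hcoe : ∀ g : Fin n → R, ((∑ i, g i • F i : splineModule G α) : Fin n → R) =
      (valueMatrix F).mulVec g := by
    intro g
    ext r
    simp [valueMatrix, Matrix.mulVec, dotProduct, mul_comm]
  have hli : LinearIndependent R F := by
    rw [Fintype.linearIndependent_iff]
    intro g hg
    have h0 : (valueMatrix F).mulVec g = 0 := by rw [← hcoe, hg]; rfl
    exact fun i => congrFun (Matrix.eq_zero_of_mulVec_eq_zero hdet h0) i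
  have hsp : ⊤ ≤ Submodule.span R (Set.range F) := by
    rintro H -
    -- Each Cramer numerator is again a determinant of splines, hence divisible by `graphQ l` and so
    -- by `det F`.
    have hx : ∀ c, ∃ x, (valueMatrix F).cramer (H : Fin n → R) c = (valueMatrix F).det * x := by
      intro c
      have : (valueMatrix F).updateCol c (H : Fin n → R) = valueMatrix (Function.update F c H) := by
        ext r k
        by_cases hk : k = c
        · subst hk
          simp [valueMatrix]
        · simp [valueMatrix, hk]
      rw [Matrix.cramer_apply, this]
      exact hF.trans (graphQ_dvd_det hl _)
    choose x hx using hx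
    have hH : H = ∑ i, x i • F i := by
      refine Subtype.ext ?_
      have h1 := Matrix.mulVec_cramer (valueMatrix F) (H : Fin n → R)
      have h2 : (valueMatrix F).cramer (H : Fin n → R) = (valueMatrix F).det • x := by
        ext c
        simpa using hx c
      rw [h2, Matrix.mulVec_smul] at h1
      rw [hcoe]
      exact (smul_right_injective _ hdet h1).symm
    rw [hH]
    exact Submodule.sum_mem _ fun i _ => Submodule.smul_mem _ _ (Submodule.subset_span ⟨i, rfl⟩)
  exact ⟨Module.Basis.mk hli hsp, fun i => by simp⟩

end Det

end GenSpline

/-- Determinantal basis criterion for generalized splines over a GCD domain. The GCD domain is a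
domain with `NormalizedGCDMonoid`, i.e. with some choice of gcds and lcms (every GCD domain has one);
the labels `α e` are nonzero principal ideals, and `l e` is any generator of `α e`. -/
theorem mainTheorem1 {R : Type*} [CommRing R] [IsDomain R] [NormalizedGCDMonoid R] {n : ℕ}
    (G : SimpleGraph (Fin n)) (α : G.EdgeLabeling (Ideal R)) (l : G.EdgeLabeling R)
    (hl : ∀ e, α e = Ideal.span {l e}) (hα : ∀ e, α e ≠ ⊥)
    (F : Fin n → GenSpline.splineModule G α) :
    (∃ b : Module.Basis (Fin n) R (GenSpline.splineModule G α), ∀ i, b i = F i) ↔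
      ∃ r : Rˣ, (GenSpline.splineMatrix F).det = r * GenSpline.graphQ l := by
  have hassoc := GenSpline.associated_det_splineMatrix F
  constructor
  · rintro ⟨b, hb⟩
    obtain rfl : ⇑b = F := funext hb
    obtain ⟨r, hr⟩ := (associated_of_dvd_dvd (GenSpline.graphQ_dvd_det hl b)
      (GenSpline.det_dvd_graphQ hl b)).trans hassoc.symm
    exact ⟨r, by rw [← hr, mul_comm]⟩
  · rintro ⟨r, hr⟩
    have hl0 : ∀ e, l e ≠ 0 := fun e he => hα e (by rw [hl, he, Ideal.span_singleton_eq_bot])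
    refine GenSpline.exists_basis_of_det_dvd_graphQ hl hl0 (hassoc.symm.dvd.trans ?_)
    rw [hr]
    exact Units.mul_left_dvd.2 dvd_rfl
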